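/- Let $\mathfrak H$ be a complex Hilbert space. A linear relation $H$ in $\mathfrak H$ is a linear subspace of $\mathfrak H\times\mathfrak H$; put $$\operatorname{dom}H=\{f:\{f,f'\}\in H\text{ for some }f'\},\qquad \operatorname{mul}H=\{f':\{0,f'\}\in H\},$$ $$H^{-1}=\{\{f',f\}:\{f,f'\}\in H\},\qquad H+x=\{\{f,f'+xf\}:\{f,f'\}\in H\}\quad(x\in\mathbb R),$$ $$H^*=\{\{g,g'\}\in\mathfrak H\times\mathfrak H:(f',g)=(f,g')\text{ for all }\{f,f'\}\in H\}.$$ The product of two relations is $KL=\{\{f,f'\}:\{f,\varphi\}\in L,\ \{\varphi,f'\}\in K\text{ for some }\varphi\in\mathfrak H\}$. The relation $H$ is selfadjoint if $H=H^*$, and nonnegative if $(f',f)\ge 0$ for all $\{f,f'\}\in H$. Every nonnegative selfadjoint relation $H$ has a unique nonnegative selfadjoint square root $H^{1/2}$, that is, a nonnegative selfadjoint relation with $H^{1/2}H^{1/2}=H$; let $H^{1/2}_{\rm s}=\{\{f,f'\}\in H^{1/2}: f'\perp\operatorname{mul}H^{1/2}\}$ be its operator part, which is a linear operator. For nonnegative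 selfadjoint relations $H_1,H_2$ in $\mathfrak H$ one writes $H_1\le H_2$ (equivalently $H_2\ge H_1$) if $$\operatorname{dom}H_{2{\rm s}}^{1/2}\subset\operatorname{dom}H_{1{\rm s}}^{1/2}\quad\text{and}\quad \|H_{1{\rm s}}^{1/2}h\|\le\|H_{2{\rm s}}^{1/2}h\|\quad\text{for all }h\in\operatorname{dom}H_{2{\rm s}}^{1/2}.$$ **Theorem.** Let $H_1$ and $H_2$ be nonnegative selfadjoint relations in $\mathfrak H$. Then the following statements are equivalent: 1. $H_1\le H_2$; 2. $(H_1+x)^{-1}\ge(H_2+x)^{-1}$ for some $x>0$; 3. $(H_1+x)^{-1}\ge(H_2+x)^{-1}$ for every $x>0$; 4. $H_1^{-1}\ge H_2^{-1}$. -/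

import Mathlib

/-! Linear relations between complex inner product spaces: a linear relation from `E` to `F` is a
linear subspace of `E × F`, with `(f, f') ∈ H` read as "`H` sends `f` to `f'`". The adjoint relation
is Mathlib's `Submodule.adjoint`: `(g, g') ∈ H.adjoint` if and only if
`⟪f', g⟫ = ⟪f, g'⟫` for all `(f, f') ∈ H` (`Submodule.mem_adjoint_iff`). -/

/-- Linear relations from `E` to `F`. -/
abbrev LinRel (E F : Type*) [NormedAddCommGroup E] [InnerProductSpace ℂ E]
    [NormedAddCommGroup F] [InnerProductSpace ℂ F] : Type _ :=
  Submodule ℂ (E × F)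

namespace LinRel

variable {E F G : Type*} [NormedAddCommGroup E] [InnerProductSpace ℂ E]
  [NormedAddCommGroup F] [InnerProductSpace ℂ F] [NormedAddCommGroup G] [InnerProductSpace ℂ G]

/-- The domain `{f : (f, f') ∈ H for some f'}`. -/
def dom (H : LinRel E F) : Submodule ℂ E := H.map (LinearMap.fst ℂ E F)

/-- The multivalued part `{f' : (0, f') ∈ H}`. -/
def mul (H : LinRel E F) : Submodule ℂ F := H.comap (LinearMap.inr ℂ E F)

/-- The formal inverse `{(f', f) : (f, f') ∈ H}`. -/
def inverse (H : LinRel E F) : LinRel F E :=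
  H.comap ((LinearMap.snd ℂ F E).prod (LinearMap.fst ℂ F E))

/-- The (operatorwise) sum `{(f, f' + f'') : (f, f') ∈ H₁, (f, f'') ∈ H₂}`. -/
def sum (H₁ H₂ : LinRel E F) : LinRel E F where
  carrier := {p | ∃ f' f'' : F, (p.1, f') ∈ H₁ ∧ (p.1, f'') ∈ H₂ ∧ p.2 = f' + f''}
  zero_mem' := ⟨0, 0, H₁.zero_mem, H₂.zero_mem, by simp⟩
  add_mem' := by
    rintro p q ⟨a, b, ha, hb, hp⟩ ⟨c, d, hc, hd, hq⟩
    refine ⟨a + c, b + d, H₁.add_mem ha hc, H₂.add_mem hb hd, ?_⟩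
    rw [Prod.snd_add, hp, hq]
    abel
  smul_mem' := by
    rintro t p ⟨a, b, ha, hb, hp⟩
    refine ⟨t • a, t • b, H₁.smul_mem t ha, H₂.smul_mem t hb, ?_⟩
    rw [Prod.smul_snd, hp, smul_add]

/-- The product `H₂ H₁ = {(f, f') : (f, φ) ∈ H₁ and (φ, f') ∈ H₂ for some φ}`. -/
def product (H₂ : LinRel F G) (H₁ : LinRel E F) : LinRel E G where
  carrier := {p | ∃ φ : F, (p.1, φ) ∈ H₁ ∧ (φ, p.2) ∈ H₂}
  zero_mem' := ⟨0, H₁.zero_mem, H₂.zero_mem⟩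
  add_mem' := by
    rintro p q ⟨a, ha, hp⟩ ⟨b, hb, hq⟩
    exact ⟨a + b, H₁.add_mem ha hb, H₂.add_mem hp hq⟩
  smul_mem' := by
    rintro t p ⟨a, ha, hp⟩
    exact ⟨t • a, H₁.smul_mem t ha, H₂.smul_mem t hp⟩

/-- The relation `H + x`, that is, the sum of `H` and the graph of `x` times the identity. -/
noncomputable def shift (H : LinRel E E) (x : ℝ) : LinRel E E :=
  sum H ((x : ℂ) • (LinearMap.id : E →ₗ[ℂ] E)).graph

/-- The operator part `H ⊖ ({0} × mul H)` of `H`: those `(f, f') ∈ H` that are orthogonal to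
`{0} × mul H` in the Hilbert space `E × F`, i.e. those for which `f'` is orthogonal to `mul H`. -/
noncomputable def operatorPart (H : LinRel E F) : LinRel E F :=
  H ⊓ (mul H)ᗮ.comap (LinearMap.snd ℂ E F)

/-- `H` is nonnegative and selfadjoint: `H = H*`, and `(f', f)` is a nonnegative real number for
every `(f, f') ∈ H`. -/
structure IsNonnegSelfAdjoint (H : LinRel E E) : Prop where
  adjoint_eq : H.adjoint = H
  inner_im : ∀ f f' : E, (f, f') ∈ H → (inner ℂ f' f).im = 0
  inner_re : ∀ f f' : E, (f, f') ∈ H → 0 ≤ (inner ℂ f' f).re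

/-- `K` is a nonnegative selfadjoint square root of `H`: `K` is nonnegative selfadjoint and
`K K = H`. In a Hilbert space every nonnegative selfadjoint relation has exactly one, written
`H^(1/2)`. -/
structure IsSqrt (K H : LinRel E E) : Prop where
  nonnegSelfAdjoint : IsNonnegSelfAdjoint K
  product_self : product K K = H

/-- The ordering `H₁ ≤ H₂` of nonnegative selfadjoint relations: with `Kᵢ = Hᵢ^(1/2)` and with `Sᵢ`
the operator part of `Kᵢ`, one has `dom S₂ ⊆ dom S₁` and `‖S₁ h‖ ≤ ‖S₂ h‖` for all `h ∈ dom S₂`.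
(`Sᵢ` is single-valued, so `kᵢ` below is `Sᵢ h`.) -/
def FormLE (H₁ H₂ : LinRel E E) : Prop :=
  ∃ K₁ K₂ : LinRel E E, IsSqrt K₁ H₁ ∧ IsSqrt K₂ H₂ ∧
    dom (operatorPart K₂) ≤ dom (operatorPart K₁) ∧
    ∀ h k₁ k₂ : E, (h, k₁) ∈ operatorPart K₁ → (h, k₂) ∈ operatorPart K₂ → ‖k₁‖ ≤ ‖k₂‖

end LinRel

/-! For fixed `x > 0`, the conditions on `H₁`, `H₂` and on the inverses of their shifts both amount
to one inequality (`ResolventLE`) between the quadratic forms `(f, (Hᵢ + x)⁻¹ f)`. The inverses of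
the shifts are everywhere defined, so their form order is just the order of these quadratic forms
(`formLE_inverse_shift_iff`). For `H₁ ≤ H₂` the reason is duality: `(f, (Hᵢ + x)⁻¹ f)` is the
squared dual norm of `(f, ·)` with respect to the form norm `(‖Sᵢ h‖² + x ‖h‖²)^(1/2)`, with `Sᵢ`
the operator part of the root, and a smaller norm means a larger dual norm
(`formLE_iff_resolventLE`). The inverses are handled at `x = 1` by `(H⁻¹ + 1)⁻¹ = 1 - (H + 1)⁻¹`.
Uniqueness of square roots is never needed: the passage from forms to resolvents works for any
roots, and the converse uses roots constructed by functional calculus. -/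

section

open scoped InnerProductSpace ComplexOrder

/-- A functional `φ` that is dominated by a linear map `T` into a Hilbert space is represented
through `T` by a vector of that Hilbert space. -/
lemma exists_inner_eq_of_norm_le {X W : Type*} [AddCommGroup X] [Module ℂ X]
    [NormedAddCommGroup W] [InnerProductSpace ℂ W] [CompleteSpace W]
    (T : X →ₗ[ℂ] W) (φ : X →ₗ[ℂ] ℂ) {C : ℝ} (hC : 0 ≤ C) (h : ∀ x, ‖φ x‖ ≤ C * ‖T x‖) :
    ∃ u : W, ‖u‖ ≤ C ∧ ∀ x, φ x = ⟪u, T x⟫_ℂ := by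
  have hker : LinearMap.ker T.rangeRestrict ≤ LinearMap.ker φ := by
    intro x hx
    have hx' : T x = 0 := by simpa using hx
    simpa [hx'] using h x
  -- Since `ker T ≤ ker φ`, composing `φ` with a linear section of `T` gives a functional on the
  -- range of `T`, bounded by `C`; Hahn–Banach and Riesz then apply.
  obtain ⟨s, hs⟩ := T.rangeRestrict.exists_rightInverse_of_surjective T.range_rangeRestrict
  have hψ : ∀ x, φ (s (T.rangeRestrict x)) = φ x := by
    intro x
    have : s (T.rangeRestrict x) - x ∈ LinearMap.ker φ := hker <| by
      have := LinearMap.congr_fun hs (T.rangeRestrict x)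
      simp only [LinearMap.comp_apply, LinearMap.id_apply] at this
      rw [LinearMap.mem_ker, map_sub, this, sub_self]
    rwa [LinearMap.mem_ker, map_sub, sub_eq_zero] at this
  let ψ : StrongDual ℂ (LinearMap.range T) := (φ ∘ₗ s).mkContinuous C <| by
    rintro ⟨_, x, rfl⟩
    have := hψ x
    simp only [LinearMap.comp_apply]
    exact (congrArg norm this).trans_le (h x)
  obtain ⟨g, hg, hgn⟩ := exists_extension_norm_eq (LinearMap.range T) ψ
  refine ⟨(InnerProductSpace.toDual ℂ W).symm g, ?_, fun x ↦ ?_⟩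
  · rw [LinearIsometryEquiv.norm_map, hgn]
    exact LinearMap.mkContinuous_norm_le _ hC _
  · rw [InnerProductSpace.toDual_symm_apply]
    exact (hψ x).symm.trans (hg (T.rangeRestrict x)).symm

/-! ### Nonnegative selfadjoint relations and their resolvents. -/

namespace LinRel

variable {E : Type*} [NormedAddCommGroup E] [InnerProductSpace ℂ E]

lemma mem_inverse {H : LinRel E E} {f g : E} : (f, g) ∈ H.inverse ↔ (g, f) ∈ H := Iff.rfl

lemma mem_shift {H : LinRel E E} {x : ℝ} {f g : E} :
    (f, g) ∈ H.shift x ↔ (f, g - (x : ℂ) • f) ∈ H := by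
  constructor
  · rintro ⟨a, b, ha, hb, hg⟩
    have hb' : b = (x : ℂ) • f := by simpa [LinearMap.mem_graph_iff] using hb
    have hg' : g = a + b := hg
    rw [hg', hb', add_sub_cancel_right]
    exact ha
  · intro h
    exact ⟨g - (x : ℂ) • f, (x : ℂ) • f, h, by simp [LinearMap.mem_graph_iff], by simp⟩

lemma mem_product {K L : LinRel E E} {f g : E} :
    (f, g) ∈ product K L ↔ ∃ k, (f, k) ∈ L ∧ (k, g) ∈ K := Iff.rfl

lemma mem_dom {H : LinRel E E} {f : E} : f ∈ dom H ↔ ∃ g, (f, g) ∈ H := by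
  simp [dom]

lemma isClosed_adjoint (H : LinRel E E) : IsClosed (H.adjoint : Set (E × E)) := by
  have : (H.adjoint : Set (E × E)) =
      ⋂ p : H, {q : E × E | ⟪(p : E × E).2, q.1⟫_ℂ - ⟪(p : E × E).1, q.2⟫_ℂ = 0} := by
    ext q
    simp only [SetLike.mem_coe, Submodule.mem_adjoint_iff, Set.mem_iInter, Set.mem_ofPred_eq,
      Subtype.forall, Prod.forall]
  rw [this]
  exact isClosed_iInter fun p ↦ isClosed_eq (by fun_prop) continuous_const

namespace IsNonnegSelfAdjoint

variable {H : LinRel E E} (hH : IsNonnegSelfAdjoint H)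
include hH

lemma mem_iff {g g' : E} : (g, g') ∈ H ↔ ∀ f f', (f, f') ∈ H → ⟪f', g⟫_ℂ = ⟪f, g'⟫_ℂ := by
  conv_lhs => rw [← hH.adjoint_eq]
  simp [sub_eq_zero]

lemma inner_eq {f f' g g' : E} (hf : (f, f') ∈ H) (hg : (g, g') ∈ H) :
    ⟪f', g⟫_ℂ = ⟪f, g'⟫_ℂ := hH.mem_iff.1 hg f f' hf

lemma isClosed : IsClosed (H : Set (E × E)) := hH.adjoint_eq ▸ isClosed_adjoint H

lemma mem_mul_orthogonal {f f' : E} (hf : (f, f') ∈ H) : f ∈ (mul H)ᗮ := by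
  rw [Submodule.mem_orthogonal]
  intro u hu
  simpa using hH.inner_eq hu hf

lemma re_inner_nonneg {f f' : E} (hf : (f, f') ∈ H) : 0 ≤ (⟪f, f'⟫_ℂ).re := by
  rw [← inner_conj_symm]
  exact hH.inner_re f f' hf

lemma inverse : IsNonnegSelfAdjoint H.inverse where
  adjoint_eq := by
    ext ⟨g, g'⟩
    rw [mem_inverse, hH.mem_iff, Submodule.mem_adjoint_iff]
    simp only [mem_inverse, sub_eq_zero]
    exact ⟨fun h f f' hf ↦ (h f' f hf).symm, fun h f f' hf ↦ (h f' f hf).symm⟩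
  inner_im f f' hf := by
    rw [← inner_conj_symm, Complex.conj_im, hH.inner_im f' f hf, neg_zero]
  inner_re f f' hf := hH.re_inner_nonneg hf

lemma shift {x : ℝ} (hx : 0 ≤ x) : IsNonnegSelfAdjoint (H.shift x) where
  adjoint_eq := by
    ext ⟨g, g'⟩
    rw [mem_shift, hH.mem_iff, Submodule.mem_adjoint_iff]
    simp only [mem_shift, sub_eq_zero]
    constructor
    · intro h f f' hf
      have := h f (f' + (x : ℂ) • f) (by simpa using hf)
      rw [inner_add_left, inner_smul_left, Complex.conj_ofReal] at this
      rw [inner_sub_right, inner_smul_right, ← this, add_sub_cancel_right]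
    · intro h f f' hf
      have := h f (f' - (x : ℂ) • f) hf
      rw [inner_sub_left, inner_smul_left, Complex.conj_ofReal, inner_sub_right,
        inner_smul_right] at this
      exact sub_left_injective this
  inner_im f f' hf := by
    have h := hH.inner_im _ _ (mem_shift.1 hf)
    have h' : (⟪f, f⟫_ℂ).im = 0 := inner_self_im (𝕜 := ℂ) f
    rw [inner_sub_left, inner_smul_left, Complex.conj_ofReal, Complex.sub_im, Complex.im_ofReal_mul, h',
      mul_zero, sub_zero] at h
    exact h
  inner_re f f' hf := by
    have h := hH.inner_re _ _ (mem_shift.1 hf)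
    have h' : 0 ≤ (⟪f, f⟫_ℂ).re := inner_self_nonneg (𝕜 := ℂ) (x := f)
    rw [inner_sub_left, inner_smul_left, Complex.conj_ofReal, Complex.sub_re,
      Complex.re_ofReal_mul] at h
    nlinarith [mul_nonneg hx h']

lemma norm_sq_le_norm_add_sq {f f' : E} (hf : (f, f') ∈ H) {x : ℝ} (hx : 0 ≤ x) :
    ‖f'‖ ^ 2 + (x * ‖f‖) ^ 2 ≤ ‖f' + (x : ℂ) • f‖ ^ 2 := by
  have h := hH.inner_re f f' hf
  rw [norm_add_sq (𝕜 := ℂ), norm_smul, inner_smul_right, Complex.norm_real, Real.norm_of_nonneg hx]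
  have : RCLike.re ((x : ℂ) * ⟪f', f⟫_ℂ) = x * (⟪f', f⟫_ℂ).re := Complex.re_ofReal_mul _ _
  rw [this]
  nlinarith [mul_nonneg hx h]

/-- Nonnegativity makes `(f, f') ↦ f' + x f` bounded below on the closed space `H`, so its range is
closed; selfadjointness makes the range dense. -/
lemma exists_resolvent [CompleteSpace E] {x : ℝ} (hx : 0 < x) :
    ∃ R : E →L[ℂ] E, ∀ f g, (g, f - (x : ℂ) • g) ∈ H ↔ g = R f := by
  let Ψ : H →L[ℂ] E := (ContinuousLinearMap.snd ℂ E E +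
    (x : ℂ) • ContinuousLinearMap.fst ℂ E E) ∘L H.subtypeL
  have hΨ : ∀ p : H, Ψ p = (p : E × E).2 + (x : ℂ) • (p : E × E).1 := fun p ↦ rfl
  have : CompleteSpace H := hH.isClosed.completeSpace_coe
  have hanti : AntilipschitzWith ⟨max 1 x⁻¹, by positivity⟩ Ψ := by
    refine ContinuousLinearMap.antilipschitz_of_bound _ fun p ↦ ?_
    have h := hH.norm_sq_le_norm_add_sq (f := (p : E × E).1) (f' := (p : E × E).2) p.2 hx.le
    rw [← hΨ] at h
    have h2 : ‖(p : E × E).2‖ ≤ ‖Ψ p‖ := by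
      refine abs_le_of_sq_le_sq' ?_ (norm_nonneg _) |>.2
      nlinarith [sq_nonneg (x * ‖(p : E × E).1‖)]
    have h1 : x * ‖(p : E × E).1‖ ≤ ‖Ψ p‖ := by
      refine abs_le_of_sq_le_sq' ?_ (norm_nonneg _) |>.2
      nlinarith [sq_nonneg (‖(p : E × E).2‖)]
    change max ‖(p : E × E).1‖ ‖(p : E × E).2‖ ≤ max 1 x⁻¹ * ‖Ψ p‖
    refine max_le ?_ ?_
    · calc ‖(p : E × E).1‖ ≤ x⁻¹ * ‖Ψ p‖ := by
            rw [inv_mul_eq_div, le_div_iff₀ hx]; linarith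
        _ ≤ _ := by gcongr; exact le_max_right _ _
    · calc ‖(p : E × E).2‖ ≤ 1 * ‖Ψ p‖ := by rwa [one_mul]
        _ ≤ _ := by gcongr; exact le_max_left _ _
  have hcl : IsClosed (LinearMap.range (Ψ : H →ₗ[ℂ] E) : Set E) :=
    hanti.isClosed_range Ψ.uniformContinuous
  have hrange : LinearMap.range (Ψ : H →ₗ[ℂ] E) = ⊤ := by
    have : CompleteSpace (LinearMap.range (Ψ : H →ₗ[ℂ] E)) := hcl.completeSpace_coe
    rw [← Submodule.orthogonal_eq_bot_iff, Submodule.eq_bot_iff]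
    intro g hg
    -- Orthogonality to the range says that `(g, -x g)` lies in `H* = H`, and nonnegativity then
    -- forces `g = 0`.
    have hgH : (g, -((x : ℂ) • g)) ∈ H := by
      rw [hH.mem_iff]
      intro f f' hf
      have := (Submodule.mem_orthogonal _ _).1 hg (Ψ ⟨(f, f'), hf⟩) ⟨_, rfl⟩
      rw [hΨ, inner_add_left, inner_smul_left, Complex.conj_ofReal] at this
      rw [inner_neg_right, inner_smul_right]
      exact eq_neg_of_add_eq_zero_left this
    have := hH.re_inner_nonneg hgH
    rw [inner_neg_right, inner_smul_right, Complex.neg_re, Complex.re_ofReal_mul,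
      ← RCLike.re_eq_complex_re, inner_self_eq_norm_sq] at this
    have h0 : ‖g‖ ^ 2 ≤ 0 := by
      by_contra! hlt
      nlinarith [mul_pos hx hlt]
    simpa using le_antisymm h0 (by positivity)
  let e : H ≃L[ℂ] E := ContinuousLinearEquiv.ofBijective Ψ
    (LinearMap.ker_eq_bot.2 hanti.injective) hrange
  refine ⟨ContinuousLinearMap.fst ℂ E E ∘L H.subtypeL ∘L (e.symm : E →L[ℂ] H), fun f g ↦ ?_⟩
  constructor
  · intro hg
    have : e ⟨(g, f - (x : ℂ) • g), hg⟩ = f := by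
      change f - (x : ℂ) • g + (x : ℂ) • g = f
      simp
    rw [← this]
    simp
  · rintro rfl
    have h : ((e.symm f : H) : E × E).2 + (x : ℂ) • ((e.symm f : H) : E × E).1 = f :=
      e.apply_symm_apply f
    have h' : f - (x : ℂ) • ((e.symm f : H) : E × E).1 = ((e.symm f : H) : E × E).2 := by
      rw [sub_eq_iff_eq_add]; exact h.symm
    change (((e.symm f : H) : E × E).1, f - (x : ℂ) • ((e.symm f : H) : E × E).1) ∈ H
    rw [h']
    exact (e.symm f).2

lemma inner_nonneg {f f' : E} (hf : (f, f') ∈ H) : 0 ≤ ⟪f', f⟫_ℂ :=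
  Complex.nonneg_iff.2 ⟨hH.inner_re f f' hf, (hH.inner_im f f' hf).symm⟩

lemma inner_nonneg' {f f' : E} (hf : (f, f') ∈ H) : 0 ≤ ⟪f, f'⟫_ℂ := hH.inverse.inner_nonneg hf

end IsNonnegSelfAdjoint

/-! ### Construction of square roots. -/

lemma _root_.ContinuousLinearMap.nonneg_of_inner_nonneg {T : E →L[ℂ] E}
    (h : ∀ f, 0 ≤ ⟪T f, f⟫_ℂ) : 0 ≤ T := by
  rw [ContinuousLinearMap.nonneg_iff_isPositive, ContinuousLinearMap.isPositive_iff_complex]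
  intro f
  obtain ⟨hre, him⟩ := Complex.nonneg_iff.1 (h f)
  exact ⟨Complex.ext (by simp) (by simpa using him), hre⟩

/-- For commuting bounded selfadjoint operators with `A² + B² = 1`, the relation
`{(A u, B u) : u ∈ E}` is the solution space of `B g = A g'`. -/
lemma mem_range_prod_iff {A B : E →L[ℂ] E} (hc : Commute A B) (hAB : A * A + B * B = 1)
    {g g' : E} :
    (g, g') ∈ LinearMap.range (A.prod B : E →ₗ[ℂ] E × E) ↔ B g = A g' := by
  have hc' : ∀ u, A (B u) = B (A u) := fun u ↦ DFunLike.congr_fun hc.eq u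
  have hAB' : ∀ u, A (A u) + B (B u) = u := fun u ↦ DFunLike.congr_fun hAB u
  constructor
  · rintro ⟨u, hu⟩
    have h1 : A u = g := congrArg Prod.fst hu
    have h2 : B u = g' := congrArg Prod.snd hu
    rw [← h1, ← h2, hc']
  · intro h
    -- If `g = A u` and `g' = B u`, then `A² + B² = 1` forces `u = A g + B g'`.
    refine ⟨A g + B g', Prod.ext ?_ ?_⟩
    · change A (A g + B g') = g
      rw [map_add, hc', ← h, hAB']
    · change B (A g + B g') = g'
      rw [map_add, ← hc', h, hAB']

lemma isNonnegSelfAdjoint_range_prod [CompleteSpace E] {A B : E →L[ℂ] E} (hc : Commute A B)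
    (hAB : A * A + B * B = 1) (hA : 0 ≤ A) (hB : 0 ≤ B) :
    IsNonnegSelfAdjoint (LinearMap.range (A.prod B : E →ₗ[ℂ] E × E)) := by
  have hA' := (ContinuousLinearMap.nonneg_iff_isPositive A).1 hA
  have hB' := (ContinuousLinearMap.nonneg_iff_isPositive B).1 hB
  have hpos := (ContinuousLinearMap.nonneg_iff_isPositive _).1 (hc.mul_nonneg hA hB)
  have key : ∀ f f', (f, f') ∈ LinearMap.range (A.prod B : E →ₗ[ℂ] E × E) → 0 ≤ ⟪f', f⟫_ℂ := by
    rintro _ _ ⟨u, hu⟩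
    obtain ⟨rfl, rfl⟩ := Prod.mk.inj hu
    change 0 ≤ ⟪B u, A u⟫_ℂ
    rw [← hA'.inner_left_eq_inner_right]
    exact hpos.inner_nonneg_left u
  refine ⟨?_, fun f f' hf ↦ ((Complex.nonneg_iff.1 (key f f' hf)).2).symm,
    fun f f' hf ↦ (Complex.nonneg_iff.1 (key f f' hf)).1⟩
  ext ⟨g, g'⟩
  rw [mem_range_prod_iff hc hAB, Submodule.mem_adjoint_iff]
  have hu : ∀ u, ⟪B u, g⟫_ℂ - ⟪A u, g'⟫_ℂ = ⟪u, B g - A g'⟫_ℂ := fun u ↦ by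
    rw [hA'.inner_left_eq_inner_right, hB'.inner_left_eq_inner_right, inner_sub_right]
  constructor
  · intro h
    have := (hu (B g - A g')).symm.trans (h _ _ ⟨_, rfl⟩)
    exact sub_eq_zero.1 (inner_self_eq_zero.1 this)
  · rintro h _ _ ⟨u, hfu⟩
    obtain ⟨rfl, rfl⟩ := Prod.mk.inj hfu
    exact (hu u).trans (by rw [h, sub_self, inner_zero_right])

/-- With `R = (H + 1)⁻¹`, `H` consists of the pairs `(R w, (1 - R) w)`. The commuting roots `A = √R`
and `B = √(1 - R)` give the relation of pairs `(A u, B u)`, whose square consists of the pairs `(A²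
w, B² w)`. -/
lemma IsNonnegSelfAdjoint.exists_isSqrt [CompleteSpace E] {H : LinRel E E}
    (hH : IsNonnegSelfAdjoint H) : ∃ K, IsSqrt K H := by
  obtain ⟨R, hR⟩ := hH.exists_resolvent one_pos
  simp only [Complex.ofReal_one, one_smul] at hR
  have hmem : ∀ f, (R f, f - R f) ∈ H := fun f ↦ (hR f _).2 rfl
  have hself : ∀ f : E, 0 ≤ ⟪f, f⟫_ℂ := fun f ↦ by
    rw [inner_self_eq_norm_sq_to_K]; positivity
  have hR0 : 0 ≤ R := ContinuousLinearMap.nonneg_of_inner_nonneg fun f ↦ by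
    have := add_nonneg (hH.inner_nonneg' (hmem f)) (hself (R f))
    rwa [← inner_add_right, sub_add_cancel] at this
  have hR1 : 0 ≤ 1 - R := ContinuousLinearMap.nonneg_of_inner_nonneg fun f ↦ by
    have := add_nonneg (hself (f - R f)) (hH.inner_nonneg (hmem f))
    rwa [← inner_add_right, sub_add_cancel] at this
  set A := CFC.sqrt R with hA
  set B := CFC.sqrt (1 - R) with hB
  have hAA : A * A = R := CFC.sqrt_mul_sqrt_self R
  have hBB : B * B = 1 - R := CFC.sqrt_mul_sqrt_self (1 - R)
  have hc : Commute A B := by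
    have h1 : Commute R (1 - R) := (Commute.one_right R).sub_right (Commute.refl R)
    have h2 : Commute A (1 - R) := h1.cfcₙ_nnreal _
    exact (h2.symm.cfcₙ_nnreal _).symm
  have hAB : A * A + B * B = 1 := by rw [hAA, hBB, add_sub_cancel]
  have hAA' : ∀ u, A (A u) = R u := fun u ↦ DFunLike.congr_fun hAA u
  have hBB' : ∀ u, B (B u) = u - R u := fun u ↦ DFunLike.congr_fun hBB u
  refine ⟨_, isNonnegSelfAdjoint_range_prod hc hAB (CFC.sqrt_nonneg _) (CFC.sqrt_nonneg _), ?_⟩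
  ext ⟨f, g⟩
  rw [mem_product]
  constructor
  · rintro ⟨k, ⟨u, hu⟩, ⟨v, hv⟩⟩
    obtain ⟨hu1, hu2⟩ := Prod.mk.inj hu
    obtain ⟨hv1, hv2⟩ := Prod.mk.inj hv
    -- The middle vector is `B u = A v`, which is exactly the condition for `u = A w`, `v = B w`.
    obtain ⟨w, hw⟩ := (mem_range_prod_iff hc hAB (g := u) (g' := v)).2 (hu2.trans hv1.symm)
    obtain ⟨hw1, hw2⟩ := Prod.mk.inj hw
    have h1 : f = R w := by rw [← hAA', ← hu1, ← hw1]; rfl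
    have h2 : g = w - R w := by rw [← hBB', ← hv2, ← hw2]; rfl
    rw [h1, h2]
    exact hmem w
  · intro h
    have h1 : f = R (g + f) := (hR (g + f) f).1 (by simpa using h)
    refine ⟨A (B (g + f)), ⟨A (g + f), Prod.ext ?_ ?_⟩, ⟨B (g + f), Prod.ext rfl ?_⟩⟩
    · exact (hAA' _).trans h1.symm
    · exact (DFunLike.congr_fun hc.eq (g + f)).symm
    · refine (hBB' _).trans ?_
      rw [← h1, add_sub_cancel_right]

/-! ### Form norms, dual norms and the resolvent inequality. -/

/-- The inequality `((H₂ + x)⁻¹ f, f) ≤ ((H₁ + x)⁻¹ f, f)` for all `f`. -/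
def ResolventLE (x : ℝ) (H₂ H₁ : LinRel E E) : Prop :=
  ∀ f g₁ g₂ : E, (g₁, f - (x : ℂ) • g₁) ∈ H₁ → (g₂, f - (x : ℂ) • g₂) ∈ H₂ →
    (⟪f, g₂⟫_ℂ).re ≤ (⟪f, g₁⟫_ℂ).re

/-- The vector `(√x h, k)` of the Hilbert space `E × E`, whose squared norm is
`‖k‖² + x ‖h‖²`. -/
noncomputable def weighted (x : ℝ) : E × E →ₗ[ℂ] WithLp 2 (E × E) :=
  (WithLp.linearEquiv 2 ℂ (E × E)).symm.toLinearMap ∘ₗ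
    LinearMap.prodMap (((√x : ℝ) : ℂ) • LinearMap.id) LinearMap.id

lemma inner_weighted {x : ℝ} (hx : 0 ≤ x) (p q : E × E) :
    ⟪weighted x p, weighted x q⟫_ℂ = x * ⟪p.1, q.1⟫_ℂ + ⟪p.2, q.2⟫_ℂ := by
  have h : ((√x : ℝ) : ℂ) * ((√x : ℝ) : ℂ) = x := by
    rw [← Complex.ofReal_mul, Real.mul_self_sqrt hx]
  rw [WithLp.prod_inner_apply]
  simp [weighted, ← h, mul_assoc]

lemma norm_weighted_sq {x : ℝ} (hx : 0 ≤ x) (p : E × E) :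
    ‖weighted x p‖ ^ 2 = x * ‖p.1‖ ^ 2 + ‖p.2‖ ^ 2 := by
  rw [← inner_self_eq_norm_sq (𝕜 := ℂ), inner_weighted hx, map_add,
    ← inner_self_eq_norm_sq (𝕜 := ℂ) p.1, ← inner_self_eq_norm_sq (𝕜 := ℂ) p.2]
  simp

section Sqrt

variable {K H : LinRel E E} (hK : IsSqrt K H)
include hK

/-- The middle vector of a factorization through `K` lies in `dom K`, hence is orthogonal to `mul
K`. -/
lemma IsSqrt.exists_factor {x : ℝ} {f h : E} (hh : (h, f - (x : ℂ) • h) ∈ H) :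
    ∃ k, (h, k) ∈ operatorPart K ∧ (k, f - (x : ℂ) • h) ∈ K := by
  rw [← hK.product_self] at hh
  obtain ⟨k, h1, h2⟩ := hh
  exact ⟨k, ⟨h1, hK.nonnegSelfAdjoint.mem_mul_orthogonal h2⟩, h2⟩

/-- With `f = h' + x h` and `(k, h') ∈ K`, the inner product of `f` with `g ∈ dom K` is the form
inner product of `(h, k)` and `(g, s) ∈ K`. -/
lemma IsSqrt.inner_eq_weighted {x : ℝ} (hx : 0 ≤ x) {f h k g s : E}
    (hk : (k, f - (x : ℂ) • h) ∈ K) (hg : (g, s) ∈ K) :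
    ⟪f, g⟫_ℂ = ⟪weighted x (h, k), weighted x (g, s)⟫_ℂ := by
  rw [inner_weighted hx, ← hK.nonnegSelfAdjoint.inner_eq hk hg, inner_sub_left, inner_smul_left,
    Complex.conj_ofReal]
  ring

lemma IsSqrt.re_inner_eq_norm_weighted_sq {x : ℝ} (hx : 0 ≤ x) {f h k : E}
    (hh : (h, k) ∈ K) (hk : (k, f - (x : ℂ) • h) ∈ K) :
    (⟪f, h⟫_ℂ).re = ‖weighted x (h, k)‖ ^ 2 := by
  rw [hK.inner_eq_weighted hx hk hh, ← inner_self_eq_norm_sq (𝕜 := ℂ)]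
  rfl

end Sqrt

lemma isClosed_operatorPart {K : LinRel E E} (hK : IsNonnegSelfAdjoint K) :
    IsClosed (operatorPart K : Set (E × E)) :=
  hK.isClosed.inter ((Submodule.isClosed_orthogonal _).preimage continuous_snd)

variable [CompleteSpace E]

omit [CompleteSpace E] in
-- By Cauchy–Schwarz in the first form, `‖g₂‖₂² = (f, g₂) ≤ ‖g₁‖₁ ‖g₂‖₁ ≤ ‖g₁‖₁ ‖g₂‖₂` in the form
-- norms, while `(f, g₁) = ‖g₁‖₁²`.
lemma FormLE.resolventLE {H₁ H₂ : LinRel E E} (h : FormLE H₁ H₂) {x : ℝ} (hx : 0 < x) :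
    ResolventLE x H₂ H₁ := by
  obtain ⟨K₁, K₂, hK₁, hK₂, hdom, hle⟩ := h
  intro f g₁ g₂ hg₁ hg₂
  obtain ⟨k₁, hgk₁, hk₁⟩ := hK₁.exists_factor hg₁
  obtain ⟨k₂, hgk₂, hk₂⟩ := hK₂.exists_factor hg₂
  obtain ⟨s, hs⟩ := mem_dom.1 (hdom (mem_dom.2 ⟨k₂, hgk₂⟩))
  have hsk := hle _ _ _ hs hgk₂
  rw [hK₁.re_inner_eq_norm_weighted_sq hx.le hgk₁.1 hk₁]
  have h2 := hK₂.re_inner_eq_norm_weighted_sq hx.le hgk₂.1 hk₂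
  have hs' : ‖weighted x (g₂, s)‖ ≤ ‖weighted x (g₂, k₂)‖ := by
    refine (sq_le_sq₀ (norm_nonneg _) (norm_nonneg _)).1 ?_
    rw [norm_weighted_sq hx.le, norm_weighted_sq hx.le]
    gcongr
  have h3 : (⟪f, g₂⟫_ℂ).re ≤ ‖weighted x (g₁, k₁)‖ * ‖weighted x (g₂, s)‖ := by
    rw [hK₁.inner_eq_weighted hx.le hk₁ hs.1]
    exact re_inner_le_norm (𝕜 := ℂ) (weighted x (g₁, k₁)) (weighted x (g₂, s))
  rw [h2] at h3 ⊢
  nlinarith [norm_nonneg (weighted x (g₁, k₁)), norm_nonneg (weighted x (g₂, k₂)),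
    mul_le_mul_of_nonneg_left hs' (norm_nonneg (weighted x (g₁, k₁))),
    sq_nonneg (‖weighted x (g₁, k₁)‖ - ‖weighted x (g₂, k₂)‖)]

/-- The functional `(h, ·)` is bounded by the second form norm of `h` times the second dual norm,
hence by the same constant times the first dual norm. Riesz in the complete first form space
represents it by some `(g, s)`, and then `g = h`. -/
lemma ResolventLE.exists_mem_operatorPart {H₁ H₂ K₁ K₂ : LinRel E E} {x : ℝ} (hx : 0 < x)
    (hr : ResolventLE x H₂ H₁) (hH₁ : IsNonnegSelfAdjoint H₁) (hH₂ : IsNonnegSelfAdjoint H₂)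
    (hK₁ : IsSqrt K₁ H₁) (hK₂ : IsSqrt K₂ H₂) {h k : E} (hk : (h, k) ∈ operatorPart K₂) :
    ∃ s, (h, s) ∈ operatorPart K₁ ∧ ‖s‖ ≤ ‖k‖ := by
  let W : Submodule ℂ (WithLp 2 (E × E)) := (operatorPart K₁).map (weighted x)
  have hx0 : √x ≠ 0 := (Real.sqrt_pos.2 hx).ne'
  have hW : IsClosed (W : Set (WithLp 2 (E × E))) := by
    have : (W : Set (WithLp 2 (E × E))) =
        (fun w ↦ (((√x)⁻¹ • (WithLp.ofLp w).1, (WithLp.ofLp w).2) : E × E)) ⁻¹'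
          (operatorPart K₁ : Set (E × E)) := by
      ext w
      constructor
      · rintro ⟨p, hp, rfl⟩
        simpa [weighted, smul_smul, inv_mul_cancel₀ hx0] using hp
      · intro hw
        refine ⟨_, hw, ?_⟩
        apply (WithLp.linearEquiv 2 ℂ (E × E)).injective
        simp [weighted, smul_smul, mul_inv_cancel₀ hx0]
        rfl
    rw [this]
    refine (isClosed_operatorPart hK₁.nonnegSelfAdjoint).preimage ?_
    fun_prop
  have : CompleteSpace W := hW.completeSpace_coe
  -- Triples `(f, g, l)` with `g = (H₁ + x)⁻¹ f`, factored through `l` in `K₁`; the norm of `T` at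
  -- such a triple is the first dual norm of `f`.
  let X : Submodule ℂ (E × (E × E)) :=
    (operatorPart K₁).comap (LinearMap.snd ℂ E (E × E)) ⊓
      K₁.comap ((LinearMap.snd ℂ E E ∘ₗ LinearMap.snd ℂ E (E × E)).prod
        (LinearMap.fst ℂ E (E × E) -
          (x : ℂ) • LinearMap.fst ℂ E E ∘ₗ LinearMap.snd ℂ E (E × E)))
  let T : X →ₗ[ℂ] W := (weighted x ∘ₗ LinearMap.snd ℂ E (E × E) ∘ₗ X.subtype).codRestrict W
    fun p ↦ ⟨_, p.2.1, rfl⟩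
  let φ : X →ₗ[ℂ] ℂ := (innerSL ℂ h).toLinearMap ∘ₗ LinearMap.fst ℂ E (E × E) ∘ₗ X.subtype
  obtain ⟨R₂, hR₂⟩ := hH₂.exists_resolvent hx
  have hbound : ∀ p, ‖φ p‖ ≤ ‖weighted x (h, k)‖ * ‖T p‖ := by
    rintro ⟨⟨f, g, l⟩, hgl, hlf⟩
    have hgl : (g, l) ∈ operatorPart K₁ := hgl
    have hlf : (l, f - (x : ℂ) • g) ∈ K₁ := hlf
    have hg : (g, f - (x : ℂ) • g) ∈ H₁ := hK₁.product_self ▸ mem_product.2 ⟨l, hgl.1, hlf⟩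
    have hg₂ := (hR₂ f _).2 rfl
    obtain ⟨l₂, hgl₂, hlf₂⟩ := hK₂.exists_factor hg₂
    have hle := hr f g _ hg hg₂
    rw [hK₁.re_inner_eq_norm_weighted_sq hx.le hgl.1 hlf,
      hK₂.re_inner_eq_norm_weighted_sq hx.le hgl₂.1 hlf₂,
      sq_le_sq₀ (norm_nonneg _) (norm_nonneg _)] at hle
    change ‖⟪h, f⟫_ℂ‖ ≤ ‖weighted x (h, k)‖ * ‖weighted x (g, l)‖
    rw [norm_inner_symm, hK₂.inner_eq_weighted hx.le hlf₂ hk.1, norm_inner_symm]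
    exact (norm_inner_le_norm _ _).trans (by gcongr)
  obtain ⟨⟨_, ⟨g, s⟩, hgs, rfl⟩, hu, hφ⟩ :=
    exists_inner_eq_of_norm_le T φ (norm_nonneg _) hbound
  have hgs : (g, s) ∈ operatorPart K₁ := hgs
  have hu : ‖weighted x (g, s)‖ ≤ ‖weighted x (h, k)‖ := hu
  obtain ⟨R₁, hR₁⟩ := hH₁.exists_resolvent hx
  have hgh : h = g := by
    -- Every `f` occurs in a triple, and the form pairing of that triple with `(g, s)` is again `(g,
    -- f)`.
    refine ext_inner_right ℂ fun f ↦ ?_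
    obtain ⟨l, hl, hlf⟩ := hK₁.exists_factor ((hR₁ f _).2 rfl)
    have h1 : ⟪h, f⟫_ℂ = ⟪weighted x (g, s), weighted x (R₁ f, l)⟫_ℂ :=
      hφ ⟨(f, R₁ f, l), hl, hlf⟩
    rw [h1, ← inner_conj_symm, ← hK₁.inner_eq_weighted hx.le hlf hgs.1, inner_conj_symm]
  subst hgh
  refine ⟨s, hgs, ?_⟩
  have := pow_le_pow_left₀ (norm_nonneg _) hu 2
  rw [norm_weighted_sq hx.le, norm_weighted_sq hx.le, add_le_add_iff_left] at this
  exact (sq_le_sq₀ (norm_nonneg _) (norm_nonneg _)).1 this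

lemma formLE_iff_resolventLE {H₁ H₂ : LinRel E E} {x : ℝ} (hx : 0 < x)
    (hH₁ : IsNonnegSelfAdjoint H₁) (hH₂ : IsNonnegSelfAdjoint H₂) :
    FormLE H₁ H₂ ↔ ResolventLE x H₂ H₁ := by
  refine ⟨fun h ↦ h.resolventLE hx, fun h ↦ ?_⟩
  obtain ⟨K₁, hK₁⟩ := hH₁.exists_isSqrt
  obtain ⟨K₂, hK₂⟩ := hH₂.exists_isSqrt
  refine ⟨K₁, K₂, hK₁, hK₂, fun g hg ↦ ?_, fun g k₁ k₂ h₁ h₂ ↦ ?_⟩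
  · obtain ⟨k, hk⟩ := mem_dom.1 hg
    obtain ⟨s, hs, -⟩ := h.exists_mem_operatorPart hx hH₁ hH₂ hK₁ hK₂ hk
    exact mem_dom.2 ⟨s, hs⟩
  · obtain ⟨s, hs, hle⟩ := h.exists_mem_operatorPart hx hH₁ hH₂ hK₁ hK₂ h₂
    have : k₁ - s = 0 := by
      have h1 : k₁ - s ∈ mul K₁ := by
        have := K₁.sub_mem h₁.1 hs.1
        rwa [Prod.mk_sub_mk, sub_self] at this
      have h2 : k₁ - s ∈ (mul K₁)ᗮ := Submodule.sub_mem _ h₁.2 hs.2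
      exact inner_self_eq_zero.1 ((Submodule.mem_orthogonal _ _).1 h2 _ h1)
    rwa [sub_eq_zero.1 this]

/-! ### Everywhere defined relations and inverses. -/

omit [CompleteSpace E] in
/-- A square root of an everywhere defined relation is an everywhere defined operator. -/
lemma IsSqrt.mem_operatorPart_iff {K G : LinRel E E} (hK : IsSqrt K G) (hG : dom G = ⊤) {f k : E} :
    (f, k) ∈ operatorPart K ↔ (f, k) ∈ K := by
  refine ⟨fun h ↦ h.1, fun h ↦ ⟨h, (Submodule.mem_orthogonal _ _).2 fun u hu ↦ ?_⟩⟩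
  -- Here `dom K ⊇ dom G` is everything, and `mul K` is orthogonal to `dom K`.
  obtain ⟨g, hg⟩ := mem_dom.1 (hG ▸ Submodule.mem_top : k ∈ dom G)
  rw [← hK.product_self] at hg
  obtain ⟨l, hl, -⟩ := hg
  simpa using hK.nonnegSelfAdjoint.inner_eq hu hl

omit [CompleteSpace E] in
lemma IsSqrt.norm_sq_eq {K G : LinRel E E} (hK : IsSqrt K G) {f g k : E}
    (hG : dom G = ⊤) (hg : (f, g) ∈ G) (hk : (f, k) ∈ K) : ‖k‖ ^ 2 = (⟪f, g⟫_ℂ).re := by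
  rw [← hK.product_self] at hg
  obtain ⟨l, hl, hlg⟩ := hg
  have : k - l = 0 := by
    have h1 : (0, k - l) ∈ K := by
      have := K.sub_mem hk hl
      rwa [Prod.mk_sub_mk, sub_self] at this
    have h2 : k - l ∈ (mul K)ᗮ := ((hK.mem_operatorPart_iff hG).2 h1).2
    exact inner_self_eq_zero.1 ((Submodule.mem_orthogonal _ _).1 h2 _ h1)
  rw [sub_eq_zero.1 this, ← hK.nonnegSelfAdjoint.inner_eq hl hlg]
  exact (inner_self_eq_norm_sq (𝕜 := ℂ) l).symm

/-- Domain inclusion is automatic for everywhere defined roots, and the squared norm of a root at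
`f` is the resolvent form at `f`. -/
lemma formLE_inverse_shift_iff {H₁ H₂ : LinRel E E} {x : ℝ} (hx : 0 < x)
    (hH₁ : IsNonnegSelfAdjoint H₁) (hH₂ : IsNonnegSelfAdjoint H₂) :
    FormLE (H₂.shift x).inverse (H₁.shift x).inverse ↔ ResolventLE x H₂ H₁ := by
  have hdom : ∀ {H : LinRel E E}, IsNonnegSelfAdjoint H → dom (H.shift x).inverse = ⊤ := by
    intro H hH
    obtain ⟨R, hR⟩ := hH.exists_resolvent hx
    exact eq_top_iff.2 fun f _ ↦ mem_dom.2 ⟨R f, mem_shift.2 ((hR f _).2 rfl)⟩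
  have hdomK : ∀ {K G : LinRel E E}, IsSqrt K G → dom G = ⊤ → ∀ f, ∃ k, (f, k) ∈ K := by
    intro K G hK hG f
    obtain ⟨g, hg⟩ := mem_dom.1 (hG ▸ Submodule.mem_top : f ∈ dom G)
    rw [← hK.product_self] at hg
    exact ⟨_, hg.choose_spec.1⟩
  have h₁ := hdom hH₁
  have h₂ := hdom hH₂
  constructor
  · rintro ⟨K₂, K₁, hK₂, hK₁, -, hle⟩ f g₁ g₂ hg₁ hg₂
    obtain ⟨k₁, hk₁⟩ := hdomK hK₁ h₁ f
    obtain ⟨k₂, hk₂⟩ := hdomK hK₂ h₂ f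
    rw [← hK₁.norm_sq_eq h₁ (mem_shift.2 hg₁) hk₁, ← hK₂.norm_sq_eq h₂ (mem_shift.2 hg₂) hk₂]
    have := hle f k₂ k₁ ((hK₂.mem_operatorPart_iff h₂).2 hk₂) ((hK₁.mem_operatorPart_iff h₁).2 hk₁)
    gcongr
  · intro hr
    obtain ⟨K₁, hK₁⟩ := (hH₁.shift hx.le).inverse.exists_isSqrt
    obtain ⟨K₂, hK₂⟩ := (hH₂.shift hx.le).inverse.exists_isSqrt
    refine ⟨K₂, K₁, hK₂, hK₁, fun f _ ↦ ?_, fun f k₂ k₁ hk₂ hk₁ ↦ ?_⟩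
    · obtain ⟨k, hk⟩ := hdomK hK₂ h₂ f
      exact mem_dom.2 ⟨k, (hK₂.mem_operatorPart_iff h₂).2 hk⟩
    · obtain ⟨g₁, hg₁⟩ := mem_dom.1 (h₁ ▸ Submodule.mem_top : f ∈ dom (H₁.shift x).inverse)
      obtain ⟨g₂, hg₂⟩ := mem_dom.1 (h₂ ▸ Submodule.mem_top : f ∈ dom (H₂.shift x).inverse)
      refine (sq_le_sq₀ (norm_nonneg _) (norm_nonneg _)).1 ?_
      rw [hK₁.norm_sq_eq h₁ hg₁ hk₁.1, hK₂.norm_sq_eq h₂ hg₂ hk₂.1]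
      exact hr f g₁ g₂ (mem_shift.1 hg₁) (mem_shift.1 hg₂)

omit [CompleteSpace E] in
/-- `(H⁻¹ + 1)⁻¹ = 1 - (H + 1)⁻¹` reverses the ordering of the resolvents at `1`. -/
lemma resolventLE_inverse_iff {H₁ H₂ : LinRel E E} :
    ResolventLE 1 H₁.inverse H₂.inverse ↔ ResolventLE 1 H₂ H₁ := by
  simp only [ResolventLE, mem_inverse, Complex.ofReal_one, one_smul]
  constructor
  · intro h f g₁ g₂ hg₁ hg₂
    have := h f (f - g₂) (f - g₁) (by simpa using hg₂) (by simpa using hg₁)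
    simp only [inner_sub_right, Complex.sub_re] at this
    linarith
  · intro h f g₂ g₁ hg₂ hg₁
    have := h f (f - g₁) (f - g₂) (by simpa using hg₁) (by simpa using hg₂)
    simp only [inner_sub_right, Complex.sub_re] at this
    linarith

end LinRel

end

theorem theorem5p2 {E : Type*} [NormedAddCommGroup E] [InnerProductSpace ℂ E] [CompleteSpace E]
    (H₁ H₂ : LinRel E E) (h₁ : LinRel.IsNonnegSelfAdjoint H₁)
    (h₂ : LinRel.IsNonnegSelfAdjoint H₂) :
    List.TFAE
      [LinRel.FormLE H₁ H₂,
       ∃ x : ℝ, 0 < x ∧ LinRel.FormLE (H₂.shift x).inverse (H₁.shift x).inverse,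
       ∀ x : ℝ, 0 < x → LinRel.FormLE (H₂.shift x).inverse (H₁.shift x).inverse,
       LinRel.FormLE H₂.inverse H₁.inverse] := by
  have key : ∀ {x : ℝ}, 0 < x → (LinRel.FormLE H₁ H₂ ↔
      LinRel.FormLE (H₂.shift x).inverse (H₁.shift x).inverse) := fun hx ↦
    (LinRel.formLE_iff_resolventLE hx h₁ h₂).trans
      (LinRel.formLE_inverse_shift_iff hx h₁ h₂).symm
  tfae_have 1 → 3 := fun h x hx ↦ (key hx).1 h
  tfae_have 3 → 2 := fun h ↦ ⟨1, one_pos, h 1 one_pos⟩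
  tfae_have 2 → 1 := fun ⟨x, hx, h⟩ ↦ (key hx).2 h
  tfae_have 1 ↔ 4 := by
    rw [LinRel.formLE_iff_resolventLE one_pos h₁ h₂,
      LinRel.formLE_iff_resolventLE one_pos h₂.inverse h₁.inverse,
      LinRel.resolventLE_inverse_iff]
  tfae_finish
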